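/- Let $n \ge 4$, let $A_1, \dots, A_n$ be nontrivial finite groups, let $G = A_1 * \dots * A_n$ be their free product and let $\mathrm{Out}(G) = \mathrm{Aut}(G)/\mathrm{Inn}(G)$. Then $\mathrm{Out}(G)$ is not hyperbolic, that is, for no finite generating set does its Cayley graph, regarded as a geodesic metric space with edges of length $1$, admit a $\delta \ge 0$ such that all geodesic triangles are $\delta$-thin (every point on one side lies within distance $\delta$ of the union of the other two sides). Moreover, for $i \ne j$ and $w \in A_j$ let $f_{A_i}^w \in \mathrm{Out}(G)$ be the class of the automorphism of $G$ that maps $a \mapsto w a w^{-1}$ for $a \in A_i$ and $a \mapsto a$ for $a \in A_k$, $k \ne i$, and let $H_i^j = \{ f_{A_i}^w : w \in A_j \}$, a subgroup of $\mathrm{Out}(G)$. Then for all distinct $j_1, j_2 \in \{1, \dots, n\}$ the set $\{1,\dots,n\} \setminus \{j_1, j_2\}$ has at least two elements, each free product $H_i^{j_1} * H_i^{j_2}$ with $i \ne j_1, j_2$ is infinite, and there is an injective homomorphism $$\bigoplus_{i \ne j_1, j_2} \left( H_i^{j_1} * H_i^{j_2} \right) \longrightarrow \mathrm{Out}(G)$$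 which on the $i$-th summand is the homomorphism induced by the inclusions of $H_i^{j_1}$ and $H_i^{j_2}$ into $\mathrm{Out}(G)$. -/

import Mathlib

/-! ### Hyperbolic geodesic spaces -/

/-- `σ` is (the image of) a geodesic segment from `x` to `y`. -/
def IsGeodesicSegment {X : Type*} [MetricSpace X] (σ : Set X) (x y : X) : Prop :=
  ∃ (L : ℝ) (γ : ℝ → X), 0 ≤ L ∧ γ 0 = x ∧ γ L = y ∧
    (∀ s ∈ Set.Icc 0 L, ∀ t ∈ Set.Icc 0 L, dist (γ s) (γ t) = |s - t|) ∧
    σ = γ '' Set.Icc 0 L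

/-- All geodesic triangles are `δ`-thin for some fixed `δ ≥ 0`. Since the vertices of the
triangle can be permuted, it is enough to speak about the points of its first side. -/
def HasThinTriangles (X : Type*) [MetricSpace X] : Prop :=
  ∃ δ : ℝ, 0 ≤ δ ∧ ∀ (x y z : X) (σ₁ σ₂ σ₃ : Set X),
    IsGeodesicSegment σ₁ x y → IsGeodesicSegment σ₂ y z → IsGeodesicSegment σ₃ z x →
      ∀ p ∈ σ₁, ∃ q ∈ σ₂ ∪ σ₃, dist p q ≤ δ

/-! ### The Cayley graph as a geodesic metric space -/

/-- Points of the geometric realization of the Cayley graph of `Γ` with respect to the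
generating set `S`: the vertices `g`, and the points at distance `t` from `g` along the edge of
length one that runs from `g` to `g * s`. Different descriptions of one point have distance
zero and are identified in `CayleyGraph` below. -/
inductive CayleyPoint {Γ : Type*} [Group Γ] (S : Set Γ) (_hS : Subgroup.closure S = ⊤)
  | vertex (g : Γ)
  | edge (g : Γ) (s : S) (t : Set.Icc (0 : ℝ) 1)

namespace CayleyPoint

variable {Γ : Type*} [Group Γ] {S : Set Γ} {hS : Subgroup.closure S = ⊤}

/-- The initial vertex of the cell that contains the point. -/
def src : CayleyPoint S hS → Γ
  | .vertex g => g
  | .edge g _ _ => g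

/-- The final vertex of the cell that contains the point. -/
def tgt : CayleyPoint S hS → Γ
  | .vertex g => g
  | .edge g s _ => g * s

/-- The length of the way to the initial vertex inside the cell. -/
def toSrc : CayleyPoint S hS → ℝ
  | .vertex _ => 0
  | .edge _ _ t => t

/-- The length of the way to the final vertex inside the cell. -/
def toTgt : CayleyPoint S hS → ℝ
  | .vertex _ => 0
  | .edge _ _ t => 1 - t

/-- The two points lie in the same closed cell. -/
def SameCell : CayleyPoint S hS → CayleyPoint S hS → Prop
  | .vertex g, .vertex g' => g = g'
  | .edge g s _, .edge g' s' _ => g = g' ∧ s = s'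
  | _, _ => False

/-- The distance of two vertices: the minimal number of edges that connect them. -/
noncomputable def vdist (S : Set Γ) (g h : Γ) : ℝ := ((SimpleGraph.mulCayley S).dist g h : ℝ)

/-- The length of a shortest way from `p` to `q` through end vertices of their cells. -/
noncomputable def throughDist (p q : CayleyPoint S hS) : ℝ :=
  min (min (p.toSrc + vdist S p.src q.src + q.toSrc) (p.toSrc + vdist S p.src q.tgt + q.toTgt))
    (min (p.toTgt + vdist S p.tgt q.src + q.toSrc) (p.toTgt + vdist S p.tgt q.tgt + q.toTgt))

open Classical in
/-- The path metric: for two points of one edge there is also the way inside that edge. -/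
noncomputable instance : Dist (CayleyPoint S hS) where
  dist p q := if p.SameCell q then min |p.toSrc - q.toSrc| (throughDist p q) else throughDist p q

theorem connected (hS : Subgroup.closure S = ⊤) : (SimpleGraph.mulCayley S).Connected := by
  have key : ∀ g : Γ, g ∈ Subgroup.closure S → ∀ h : Γ,
      (SimpleGraph.mulCayley S).Reachable h (h * g) := by
    intro g hg
    induction hg using Subgroup.closure_induction with
    | mem s hs =>
      intro h
      by_cases e : h = h * s
      · rw [← e]
      · exact SimpleGraph.Adj.reachable ((SimpleGraph.mulCayley_adj S _ _).2 ⟨e, by simp [hs]⟩)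
    | one => intro h; simp
    | mul x y _ _ hx hy => intro h; rw [← mul_assoc]; exact (hx h).trans (hy _)
    | inv x _ hx => intro h; simpa using (hx (h * x⁻¹)).symm
  refine (SimpleGraph.connected_iff _).2 ⟨fun u v => ?_, ⟨1⟩⟩
  simpa using key (u⁻¹ * v) (by rw [hS]; trivial) u

theorem vdist_self (g : Γ) : vdist S g g = 0 := by simp [vdist]

theorem vdist_nonneg (g h : Γ) : 0 ≤ vdist S g h := by simp [vdist]

theorem vdist_comm (g h : Γ) : vdist S g h = vdist S h g := by
  simp [vdist, SimpleGraph.dist_comm]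

theorem vdist_triangle (hS : Subgroup.closure S = ⊤) (g h k : Γ) :
    vdist S g k ≤ vdist S g h + vdist S h k := by
  unfold vdist; exact_mod_cast (connected hS).dist_triangle

theorem toSrc_nonneg (p : CayleyPoint S hS) : 0 ≤ p.toSrc := by
  cases p with
  | vertex g => exact le_rfl
  | edge g s t => exact t.2.1

theorem toTgt_nonneg (p : CayleyPoint S hS) : 0 ≤ p.toTgt := by
  cases p with
  | vertex g => exact le_rfl
  | edge g s t => exact sub_nonneg.2 t.2.2

theorem vdist_src_tgt (p : CayleyPoint S hS) : vdist S p.src p.tgt ≤ p.toSrc + p.toTgt := by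
  cases p with
  | vertex g => simp [src, tgt, toSrc, toTgt, vdist_self]
  | edge g s t =>
    simp only [src, tgt, toSrc, toTgt, add_sub_cancel]
    by_cases e : g = g * s
    · rw [← e, vdist_self]; exact zero_le_one
    · have : (SimpleGraph.mulCayley S).dist g (g * s) = 1 :=
        SimpleGraph.dist_eq_one_iff_adj.2 ((SimpleGraph.mulCayley_adj S _ _).2 ⟨e, by simp⟩)
      simp [vdist, this]

theorem throughDist_comm (p q : CayleyPoint S hS) : throughDist p q = throughDist q p := by
  unfold throughDist
  rw [vdist_comm p.src q.src, vdist_comm p.src q.tgt, vdist_comm p.tgt q.src,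
    vdist_comm p.tgt q.tgt]
  grind

theorem throughDist_le (p q : CayleyPoint S hS) :
    throughDist p q ≤ p.toSrc + vdist S p.src q.src + q.toSrc ∧
    throughDist p q ≤ p.toSrc + vdist S p.src q.tgt + q.toTgt ∧
    throughDist p q ≤ p.toTgt + vdist S p.tgt q.src + q.toSrc ∧
    throughDist p q ≤ p.toTgt + vdist S p.tgt q.tgt + q.toTgt := by
  simp [throughDist]

theorem throughDist_cases (p q : CayleyPoint S hS) :
    throughDist p q = p.toSrc + vdist S p.src q.src + q.toSrc ∨
    throughDist p q = p.toSrc + vdist S p.src q.tgt + q.toTgt ∨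
    throughDist p q = p.toTgt + vdist S p.tgt q.src + q.toSrc ∨
    throughDist p q = p.toTgt + vdist S p.tgt q.tgt + q.toTgt := by
  unfold throughDist
  grind

theorem throughDist_triangle (p q r : CayleyPoint S hS) :
    throughDist p r ≤ throughDist p q + throughDist q r := by
  have h1 := vdist_src_tgt q
  have h2 := vdist_comm (S := S) q.src q.tgt
  have h3 := toSrc_nonneg q
  have h4 := toTgt_nonneg q
  have t := vdist_triangle hS
  obtain ⟨m1, m2, m3, m4⟩ := throughDist_le p r
  rcases throughDist_cases p q with e | e | e | e <;>
    rcases throughDist_cases q r with e' | e' | e' | e' <;> rw [e, e']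
  · linarith [t p.src q.src r.src]
  · linarith [t p.src q.src r.tgt]
  · linarith [t p.src q.src r.src, t q.src q.tgt r.src]
  · linarith [t p.src q.src r.tgt, t q.src q.tgt r.tgt]
  · linarith [t p.src q.tgt r.src, t q.tgt q.src r.src]
  · linarith [t p.src q.tgt r.tgt, t q.tgt q.src r.tgt]
  · linarith [t p.src q.tgt r.src]
  · linarith [t p.src q.tgt r.tgt]
  · linarith [t p.tgt q.src r.src]
  · linarith [t p.tgt q.src r.tgt]
  · linarith [t p.tgt q.src r.src, t q.src q.tgt r.src]
  · linarith [t p.tgt q.src r.tgt, t q.src q.tgt r.tgt]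
  · linarith [t p.tgt q.tgt r.src, t q.tgt q.src r.src]
  · linarith [t p.tgt q.tgt r.tgt, t q.tgt q.src r.tgt]
  · linarith [t p.tgt q.tgt r.src]
  · linarith [t p.tgt q.tgt r.tgt]

theorem SameCell.symm {p q : CayleyPoint S hS} (h : p.SameCell q) : q.SameCell p := by
  cases p <;> cases q <;> simp_all [SameCell]

theorem SameCell.trans {p q r : CayleyPoint S hS} (h : p.SameCell q) (h' : q.SameCell r) :
    p.SameCell r := by
  cases p <;> cases q <;> cases r <;> simp_all [SameCell]

theorem SameCell.src_eq {p q : CayleyPoint S hS} (h : p.SameCell q) : p.src = q.src := by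
  cases p <;> cases q <;> simp_all [SameCell, src]

theorem SameCell.tgt_eq {p q : CayleyPoint S hS} (h : p.SameCell q) : p.tgt = q.tgt := by
  cases p <;> cases q <;> simp_all [SameCell, tgt]

theorem SameCell.toTgt_sub {p q : CayleyPoint S hS} (h : p.SameCell q) :
    p.toTgt - q.toTgt = q.toSrc - p.toSrc := by
  cases p <;> cases q <;> simp_all [SameCell, toTgt, toSrc]

theorem throughDist_le_of_sameCell {p q : CayleyPoint S hS} (h : p.SameCell q)
    (r : CayleyPoint S hS) : throughDist p r ≤ |p.toSrc - q.toSrc| + throughDist q r := by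
  have h1 := h.toTgt_sub
  have h2 := le_abs_self (p.toSrc - q.toSrc)
  have h3 := neg_le_abs (p.toSrc - q.toSrc)
  unfold throughDist
  rw [h.src_eq, h.tgt_eq]
  simp only [min_def]
  split_ifs <;> linarith

noncomputable instance : PseudoMetricSpace (CayleyPoint S hS) where
  dist_self p := by
    have hp : p.SameCell p := by cases p <;> simp [SameCell]
    have h1 := toSrc_nonneg p
    have h2 := toTgt_nonneg p
    have h : 0 ≤ throughDist p p := by
      simp only [throughDist, le_min_iff]
      have h3 := vdist_nonneg (S := S) p.src p.tgt
      have h4 := vdist_nonneg (S := S) p.tgt p.src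
      refine ⟨⟨?_, ?_⟩, ?_, ?_⟩ <;> linarith [vdist_self (S := S) p.src, vdist_self (S := S) p.tgt]
    simp only [dist, if_pos hp, sub_self, abs_zero]
    exact min_eq_left h
  dist_comm p q := by
    simp only [dist]
    by_cases h : p.SameCell q
    · rw [if_pos h, if_pos h.symm, throughDist_comm, abs_sub_comm]
    · rw [if_neg h, if_neg fun h' => h h'.symm, throughDist_comm]
  dist_triangle p q r := by
    have t := throughDist_triangle p q r
    have A := fun h => throughDist_le_of_sameCell (p := p) (q := q) h r
    have B := fun h => throughDist_le_of_sameCell (p := r) (q := q) h p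
    have C := abs_sub_le p.toSrc q.toSrc r.toSrc
    rw [throughDist_comm r p, throughDist_comm q p, abs_sub_comm] at B
    simp only [dist]
    by_cases h : p.SameCell q <;> by_cases h' : q.SameCell r
    · have h'' := h.trans h'
      have A := A h
      have B := B h'.symm
      simp only [if_pos h, if_pos h', if_pos h'', min_def]
      split_ifs <;> linarith
    · have h'' : ¬ p.SameCell r := fun k => h' (h.symm.trans k)
      have A := A h
      simp only [if_pos h, if_neg h', if_neg h'', min_def]
      split_ifs <;> linarith
    · have h'' : ¬ p.SameCell r := fun k => h (k.trans h'.symm)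
      have B := B h'.symm
      simp only [if_neg h, if_pos h', if_neg h'', min_def]
      split_ifs <;> linarith
    · simp only [if_neg h, if_neg h', min_def]
      split_ifs <;> linarith

end CayleyPoint

/-- The geometric realization of the Cayley graph, a metric space. -/
abbrev CayleyGraph {Γ : Type*} [Group Γ] (S : Set Γ) (hS : Subgroup.closure S = ⊤) :=
  SeparationQuotient (CayleyPoint S hS)

/-- A group is hyperbolic if its Cayley graph with respect to some finite generating set is
hyperbolic. -/
def IsHyperbolicGroup (Γ : Type*) [Group Γ] : Prop :=
  ∃ (S : Set Γ) (hS : Subgroup.closure S = ⊤), S.Finite ∧ HasThinTriangles (CayleyGraph S hS)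

/-! ### Outer automorphisms -/

/-- Inner automorphisms form a normal subgroup of the automorphism group. -/
instance conj_range_normal (G : Type*) [Group G] :
    (MulAut.conj : G →* MulAut G).range.Normal where
  conj_mem := by
    rintro _ ⟨g, rfl⟩ φ
    exact ⟨φ g, by ext x; simp⟩

/-- The outer automorphism group. -/
abbrev Out (G : Type*) [Group G] := MulAut G ⧸ (MulAut.conj : G →* MulAut G).range

/-! ### Partial conjugations of a free product -/

section PartialConj

open Monoid

variable {ι : Type*} [DecidableEq ι] {A : ι → Type*} [∀ i, Group (A i)]

/-- The endomorphism of the free product that is conjugation by `w` on the factor `A i` and the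
identity on the other factors. -/
def partialConjHom (i : ι) (w : CoprodI A) : CoprodI A →* CoprodI A :=
  CoprodI.lift fun k =>
    if k = i then (MulAut.conj w).toMonoidHom.comp CoprodI.of else CoprodI.of

theorem partialConjHom_comp_inv (i j : ι) (w : A j) :
    (partialConjHom i (CoprodI.of w⁻¹)).comp (partialConjHom i (CoprodI.of w)) =
      MonoidHom.id (CoprodI A) := by
  ext k a
  by_cases hk : k = i <;> by_cases hj : j = i <;>
    simp [partialConjHom, hk, hj, mul_assoc]

/-- The automorphism `a ↦ w * a * w⁻¹` for `a` in `A i`, `a ↦ a` for `a` in the other factors,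
where `w` is an element of the factor `A j`. -/
def partialConj (i j : ι) (w : A j) : MulAut (CoprodI A) :=
  MonoidHom.toMulEquiv (partialConjHom i (CoprodI.of w)) (partialConjHom i (CoprodI.of w⁻¹))
    (partialConjHom_comp_inv i j w)
    (by simpa using partialConjHom_comp_inv (A := A) i j w⁻¹)

/-- The outer automorphism given by `partialConj i j w`. -/
def outerPartialConj (i j : ι) (w : A j) : Out (CoprodI A) :=
  QuotientGroup.mk (partialConj i j w)

theorem partialConj_mul (i j : ι) (u v : A j) :
    ∃ w : A j, partialConj i j u * partialConj i j v = partialConj (A := A) i j w := by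
  refine ⟨if j = i then u * v else v * u, MulEquiv.toMonoidHom_injective ?_⟩
  ext k a
  by_cases hk : k = i <;> by_cases hj : j = i <;>
    simp [partialConj, partialConjHom, hk, hj, mul_assoc]

theorem partialConj_inv (i j : ι) (u : A j) :
    (partialConj i j u)⁻¹ = partialConj (A := A) i j u⁻¹ := by
  apply MulEquiv.ext
  intro x
  rfl

theorem partialConj_one (i j : ι) : partialConj (A := A) i j 1 = 1 := by
  apply MulEquiv.toMonoidHom_injective
  ext k a
  by_cases hk : k = i <;> simp [partialConj, partialConjHom, hk]

/-- The subgroup of the outer automorphisms `outerPartialConj i j w` for `w` in `A j`. -/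
def outerPartialConjSubgroup (A : ι → Type*) [∀ i, Group (A i)] (i j : ι) :
    Subgroup (Out (CoprodI A)) where
  carrier := Set.range (outerPartialConj i j)
  mul_mem' := by
    rintro _ _ ⟨u, rfl⟩ ⟨v, rfl⟩
    obtain ⟨w, hw⟩ := partialConj_mul (A := A) i j u v
    exact ⟨w, congrArg QuotientGroup.mk hw.symm⟩
  one_mem' := ⟨1, congrArg QuotientGroup.mk (partialConj_one (A := A) i j)⟩
  inv_mem' := by
    rintro _ ⟨u, rfl⟩
    exact ⟨u⁻¹, congrArg QuotientGroup.mk (partialConj_inv (A := A) i j u).symm⟩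

end PartialConj

/-! Fix distinct j₁, j₂ and let p = (p i) be a family of elements of A j₁ * A j₂, indexed by the
other i. Fixing A j₁ and A j₂ pointwise and conjugating each A i by (p i)⁻¹ gives an action on G,
because every p i is itself fixed (`multiConjHom_mul`). It stays faithful in Out(G)
(`outerMultiConj_injective`): if it is inner, by g, then g centralizes A j₁ and A j₂, so g lies in
both factors and is trivial; then p i centralizes A i, so p i lies in A i as well as in A j₁ * A j₂,
and is trivial. Centralizers are controlled by normal forms (`exists_eq_of_of_commute`). A single
coordinate in A j₁ or A j₂ gives a partial conjugation, which identifies the power of A j₁ * A j₂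
with the direct sum in question.

For n ≥ 4 there are two coordinates, and an element of infinite order in each yields commuting
elements a, b with all a^i b^j distinct. This is impossible in a hyperbolic group
(`not_isHyperbolicGroup_of_commute`): elements of length at most R that commute with a sufficiently
long g number at most linearly many in R (`exists_card_le`), whereas the a^i b^j grow quadratically.
-/

/-! ### Paths in the Cayley graph. -/

namespace CayleyPoint

variable {Γ : Type*} [Group Γ] {S : Set Γ} {hS : Subgroup.closure S = ⊤}

theorem dist_mul_left (h x y : Γ) :
    (SimpleGraph.mulCayley S).dist (h * x) (h * y) = (SimpleGraph.mulCayley S).dist x y := by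
  have adj (h u v : Γ) (huv : (SimpleGraph.mulCayley S).Adj u v) :
      (SimpleGraph.mulCayley S).Adj (h * u) (h * v) := by
    rw [SimpleGraph.mulCayley_adj'] at huv ⊢
    simpa [mul_assoc] using huv
  let e : SimpleGraph.mulCayley S ≃g SimpleGraph.mulCayley S :=
    { toEquiv := Equiv.mulLeft h
      map_rel_iff' := fun {u v} =>
        ⟨fun k => by simpa using adj h⁻¹ _ _ k, fun k => by simpa using adj h u v k⟩ }
  -- With extended distances, unreachable pairs have distance ⊤ and the bound is trivial. Applied to
  -- `e` and its inverse it gives equality.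
  have key (f : SimpleGraph.mulCayley S ≃g SimpleGraph.mulCayley S) (u v : Γ) :
      (SimpleGraph.mulCayley S).edist (f u) (f v) ≤ (SimpleGraph.mulCayley S).edist u v := by
    by_cases r : (SimpleGraph.mulCayley S).Reachable u v
    · obtain ⟨w, hw⟩ := r.exists_walk_length_eq_edist
      rw [← hw, ← SimpleGraph.Walk.length_map f.toHom w]
      exact SimpleGraph.edist_le (w.map f.toHom)
    · rw [SimpleGraph.edist_eq_top_of_not_reachable r]
      exact le_top
  have := le_antisymm (key e x y) (by simpa using key e.symm (e x) (e y))
  exact congrArg ENat.toNat this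

theorem dist_vertex_edge_le (g : Γ) (s : S) (t : Set.Icc (0 : ℝ) 1) :
    dist (vertex g : CayleyPoint S hS) (edge g s t) ≤ t := by
  have := (throughDist_le (vertex g : CayleyPoint S hS) (edge g s t)).1
  simp only [src, toSrc, vdist_self] at this
  simpa [dist, SameCell] using this

theorem dist_vertex_edge_le' (g : Γ) (s : S) (t : Set.Icc (0 : ℝ) 1) :
    dist (vertex (g * s) : CayleyPoint S hS) (edge g s t) ≤ 1 - t := by
  have := (throughDist_le (vertex (g * s) : CayleyPoint S hS) (edge g s t)).2.1
  simp only [src, tgt, toSrc, toTgt, vdist_self] at this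
  simpa [dist, SameCell] using this

theorem dist_edge_edge_le (g : Γ) (s : S) (t u : Set.Icc (0 : ℝ) 1) :
    dist (edge g s t : CayleyPoint S hS) (edge g s u) ≤ |(t : ℝ) - u| := by
  simp [dist, SameCell, toSrc]

theorem dist_vertex (g h : Γ) : dist (vertex g : CayleyPoint S hS) (vertex h) = vdist S g h := by
  by_cases e : g = h
  · subst e; rw [dist_self, vdist_self]
  · simp [dist, SameCell, throughDist, src, tgt, toSrc, toTgt, e]

variable (hS) in
/-- The vertex `g` as a point of the Cayley graph. -/
noncomputable def point (g : Γ) : CayleyGraph S hS := SeparationQuotient.mk (vertex g)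

theorem dist_point (g h : Γ) :
    dist (point hS g) (point hS h) = (SimpleGraph.mulCayley S).dist g h := by
  rw [point, point, SeparationQuotient.dist_mk, dist_vertex, vdist]

/-- Adjacent vertices are joined by a 1-Lipschitz path of length one. -/
theorem exists_edge_path {g h : Γ} (hgh : (SimpleGraph.mulCayley S).Adj g h) :
    ∃ γ : ℝ → CayleyGraph S hS, γ 0 = point hS g ∧ γ 1 = point hS h ∧
      ∀ s t : ℝ, 0 ≤ s → s ≤ t → t ≤ 1 → dist (γ s) (γ t) ≤ t - s := by
  have key (g : Γ) (σ : S) : ∃ γ : ℝ → CayleyGraph S hS, γ 0 = point hS g ∧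
      γ 1 = point hS (g * σ) ∧
      ∀ s t : ℝ, 0 ≤ s → s ≤ t → t ≤ 1 → dist (γ s) (γ t) ≤ t - s := by
    refine ⟨fun t => SeparationQuotient.mk (edge g σ (Set.projIcc 0 1 zero_le_one t)), ?_, ?_, ?_⟩
    · refine (dist_le_zero.1 ?_).symm
      rw [point, SeparationQuotient.dist_mk]
      simpa using dist_vertex_edge_le (hS := hS) g σ (Set.projIcc 0 1 zero_le_one 0)
    · refine (dist_le_zero.1 ?_).symm
      rw [point, SeparationQuotient.dist_mk]
      simpa using dist_vertex_edge_le' (hS := hS) g σ (Set.projIcc 0 1 zero_le_one 1)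
    · intro s t hs hst ht
      rw [SeparationQuotient.dist_mk, Set.projIcc_of_mem _ ⟨hs, hst.trans ht⟩,
        Set.projIcc_of_mem _ ⟨hs.trans hst, ht⟩]
      refine (dist_edge_edge_le _ _ _ _).trans_eq ?_
      rw [abs_sub_comm, abs_of_nonneg (sub_nonneg.2 hst)]
  obtain ⟨-, σ, hσ, e | e⟩ := (SimpleGraph.mulCayley_adj' S g h).1 hgh
  · subst e
    exact key g ⟨σ, hσ⟩
  -- Here the generator leads from `h` back to `g`, so the edge is traversed in reverse.
  · subst e
    obtain ⟨γ, h0, h1, hγ⟩ := key h ⟨σ, hσ⟩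
    refine ⟨fun t => γ (1 - t), by simpa using h1, by simpa using h0, fun s t hs hst ht => ?_⟩
    rw [dist_comm]
    exact (hγ _ _ (by linarith) (by linarith) (by linarith)).trans_eq (by ring)

/-- A sequence of adjacent vertices is traced out by a 1-Lipschitz path. -/
theorem exists_lipschitz_path (p : ℕ → Γ) (n : ℕ)
    (hp : ∀ i < n, (SimpleGraph.mulCayley S).Adj (p i) (p (i + 1))) :
    ∃ γ : ℝ → CayleyGraph S hS, (∀ k : ℕ, k ≤ n → γ k = point hS (p k)) ∧
      ∀ s t : ℝ, 0 ≤ s → s ≤ t → t ≤ n → dist (γ s) (γ t) ≤ t - s := by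
  induction n with
  | zero =>
    refine ⟨fun _ => point hS (p 0), fun k hk => ?_, fun s t _ hst _ => ?_⟩
    · rw [Nat.le_zero.1 hk]
    · rw [dist_self]; linarith
  | succ n ih =>
    obtain ⟨γ, h1, h2⟩ := ih fun i hi => hp i (by omega)
    obtain ⟨e, e0, e1, he⟩ := exists_edge_path (hS := hS) (hp n (by omega))
    refine ⟨fun t => if t ≤ n then γ t else e (t - n), fun k hk => ?_, fun s t hs hst ht => ?_⟩
    · beta_reduce
      rcases Nat.lt_or_ge n k with h | h
      · obtain rfl : k = n + 1 := by omega
        rw [if_neg (by push_cast; linarith)]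
        simpa using e1
      · rw [if_pos (by exact_mod_cast h)]
        exact h1 k h
    · beta_reduce
      push_cast at ht
      have hn : γ n = e 0 := by rw [h1 n le_rfl, e0]
      by_cases a : t ≤ n
      · rw [if_pos (hst.trans a), if_pos a]
        exact h2 s t hs hst a
      · rw [if_neg a]
        by_cases b : s ≤ n
        · rw [if_pos b]
          have d1 := h2 s n hs b le_rfl
          have d2 := he 0 (t - n) le_rfl (by linarith) (by linarith)
          have := dist_triangle (γ s) (γ n) (e (t - n))
          rw [hn] at this d1
          linarith
        · rw [if_neg b]
          exact (he _ _ (by linarith) (by linarith) (by linarith)).trans_eq (by ring)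

/-! ### Vertex geodesics and thin triangles. -/

/-- The sequence of vertices `p 0, …, p n` is a geodesic from `x` to `y`. -/
structure IsVertexGeodesic (S : Set Γ) (p : ℕ → Γ) (n : ℕ) (x y : Γ) : Prop where
  start : p 0 = x
  finish : p n = y
  adj : ∀ i < n, (SimpleGraph.mulCayley S).Adj (p i) (p (i + 1))
  length : (SimpleGraph.mulCayley S).dist x y = n

theorem exists_isVertexGeodesic (hS : Subgroup.closure S = ⊤) (x y : Γ) :
    ∃ p, IsVertexGeodesic S p ((SimpleGraph.mulCayley S).dist x y) x y := by
  obtain ⟨w, hw⟩ := (connected hS).exists_walk_length_eq_dist x y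
  exact ⟨w.getVert, by simp, by simp [← hw], fun i hi => w.adj_getVert_succ (by omega), rfl⟩

namespace IsVertexGeodesic

variable {p : ℕ → Γ} {n : ℕ} {x y : Γ}

theorem mul_left (h : IsVertexGeodesic S p n x y) (g : Γ) :
    IsVertexGeodesic S (fun i => g * p i) n (g * x) (g * y) where
  start := by rw [h.start]
  finish := by rw [h.finish]
  adj i hi := by
    rw [← SimpleGraph.dist_eq_one_iff_adj, dist_mul_left, SimpleGraph.dist_eq_one_iff_adj]
    exact h.adj i hi
  length := by rw [dist_mul_left, h.length]

/-- A geodesic sequence of vertices is traced out by a geodesic segment. -/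
theorem exists_path (h : IsVertexGeodesic S p n x y) :
    ∃ γ : ℝ → CayleyGraph S hS, (∀ k : ℕ, k ≤ n → γ k = point hS (p k)) ∧
      IsGeodesicSegment (γ '' Set.Icc 0 n) (point hS x) (point hS y) ∧
      ∀ s ∈ Set.Icc (0 : ℝ) n, ∀ t ∈ Set.Icc (0 : ℝ) n, dist (γ s) (γ t) = |s - t| := by
  obtain ⟨γ, h1, h2⟩ := exists_lipschitz_path (hS := hS) p n h.adj
  have h0 : γ 0 = point hS x := by simpa [h.start] using h1 0 (Nat.zero_le n)
  have hn : γ n = point hS y := by simpa [h.finish] using h1 n le_rfl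
  have iso (s t : ℝ) (hs : 0 ≤ s) (hst : s ≤ t) (ht : t ≤ n) : dist (γ s) (γ t) = t - s := by
    refine le_antisymm (h2 s t hs hst ht) ?_
    -- The ends of the path are as far apart as its length, so the Lipschitz bounds on the two outer
    -- pieces force a lower bound on the middle one.
    have e : dist (γ 0) (γ n) = n := by rw [h0, hn, dist_point, h.length]
    have d1 := h2 0 s le_rfl hs (hst.trans ht)
    have d2 := h2 t n (hs.trans hst) ht le_rfl
    linarith [dist_triangle4 (γ 0) (γ s) (γ t) (γ n)]
  have iso' : ∀ s ∈ Set.Icc (0 : ℝ) n, ∀ t ∈ Set.Icc (0 : ℝ) n, dist (γ s) (γ t) = |s - t| := by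
    intro s hs t ht
    rcases le_total s t with hst | hst
    · rw [iso s t hs.1 hst ht.2, abs_sub_comm, abs_of_nonneg (sub_nonneg.2 hst)]
    · rw [dist_comm, iso t s ht.1 hst hs.2, abs_of_nonneg (sub_nonneg.2 hst)]
  exact ⟨γ, h1, ⟨n, γ, n.cast_nonneg, h0, hn, iso', rfl⟩, iso'⟩

theorem dist_eq (hS : Subgroup.closure S = ⊤) (h : IsVertexGeodesic S p n x y) {i j : ℕ}
    (hij : i ≤ j) (hj : j ≤ n) : (SimpleGraph.mulCayley S).dist (p i) (p j) = j - i := by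
  obtain ⟨γ, h1, -, h2⟩ := h.exists_path (hS := hS)
  have := h2 i ⟨i.cast_nonneg, by exact_mod_cast hij.trans hj⟩ j
    ⟨j.cast_nonneg, by exact_mod_cast hj⟩
  rw [h1 i (hij.trans hj), h1 j hj, dist_point, abs_sub_comm,
    abs_of_nonneg (sub_nonneg.2 (by exact_mod_cast hij)), ← Nat.cast_sub hij] at this
  exact_mod_cast this

end IsVertexGeodesic

/-- Thin triangles in terms of vertices: each vertex of one side is close to a vertex of another. -/
theorem exists_thin_vertex (hX : HasThinTriangles (CayleyGraph S hS)) :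
    ∃ D : ℕ, ∀ (x y z : Γ) (p q r : ℕ → Γ) (l m n : ℕ), IsVertexGeodesic S p l x y →
      IsVertexGeodesic S q m y z → IsVertexGeodesic S r n z x → ∀ i ≤ l,
        (∃ j ≤ m, (SimpleGraph.mulCayley S).dist (p i) (q j) ≤ D) ∨
        (∃ j ≤ n, (SimpleGraph.mulCayley S).dist (p i) (r j) ≤ D) := by
  obtain ⟨δ, -, hδ⟩ := hX
  -- The additional 1 pays for moving a point of a side back to the preceding vertex.
  obtain ⟨D, hD⟩ := exists_nat_ge (δ + 1)
  refine ⟨D, fun x y z p q r l m n hp hq hr i hi => ?_⟩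
  obtain ⟨γ₁, v₁, g₁, -⟩ := hp.exists_path (hS := hS)
  obtain ⟨γ₂, v₂, g₂, i₂⟩ := hq.exists_path (hS := hS)
  obtain ⟨γ₃, v₃, g₃, i₃⟩ := hr.exists_path (hS := hS)
  have round (γ : ℝ → CayleyGraph S hS) (q : ℕ → Γ) (m : ℕ)
      (v : ∀ k : ℕ, k ≤ m → γ k = point hS (q k))
      (iso : ∀ s ∈ Set.Icc (0 : ℝ) m, ∀ t ∈ Set.Icc (0 : ℝ) m, dist (γ s) (γ t) = |s - t|)
      (t : ℝ) (ht : t ∈ Set.Icc (0 : ℝ) m) (hd : dist (γ₁ i) (γ t) ≤ δ) :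
      ∃ j ≤ m, (SimpleGraph.mulCayley S).dist (p i) (q j) ≤ D := by
    have f1 := Nat.floor_le ht.1
    have f2 := Nat.lt_floor_add_one t
    have fm : ⌊t⌋₊ ≤ m := by exact_mod_cast f1.trans ht.2
    refine ⟨⌊t⌋₊, fm, ?_⟩
    have e := iso t ht ⌊t⌋₊ ⟨by positivity, f1.trans ht.2⟩
    rw [abs_of_nonneg (sub_nonneg.2 f1)] at e
    have := dist_triangle (γ₁ i) (γ t) (γ ⌊t⌋₊)
    rw [v₁ i hi, v _ fm, dist_point] at this
    rw [v₁ i hi] at hd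
    rw [v _ fm] at e
    have : ((SimpleGraph.mulCayley S).dist (p i) (q ⌊t⌋₊) : ℝ) ≤ D := by linarith
    exact_mod_cast this
  obtain ⟨b, hb | hb, hd⟩ := hδ _ _ _ _ _ _ g₁ g₂ g₃ (γ₁ i)
    ⟨i, ⟨i.cast_nonneg, by exact_mod_cast hi⟩, rfl⟩
  · obtain ⟨t, ht, rfl⟩ := hb
    exact Or.inl (round γ₂ q m v₂ i₂ t ht hd)
  · obtain ⟨t, ht, rfl⟩ := hb
    exact Or.inr (round γ₃ r n v₃ i₃ t ht hd)

/-- A geodesic of length r + 1 ends with one generator or inverse generator after a vertex at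
distance r, so each ball is covered by finitely many products. -/
theorem finite_ball (hS : Subgroup.closure S = ⊤) (hfin : S.Finite) (r : ℕ) :
    {g : Γ | (SimpleGraph.mulCayley S).dist 1 g ≤ r}.Finite := by
  induction r with
  | zero =>
    refine (Set.finite_singleton (1 : Γ)).subset fun g hg => ?_
    exact ((connected hS).dist_eq_zero_iff.1 (Nat.le_zero.1 hg)).symm
  | succ r ih =>
    refine (ih.union (Set.Finite.image2 (· * ·) ih (hfin.union hfin.inv))).subset fun g hg => ?_
    obtain ⟨p, hp⟩ := exists_isVertexGeodesic hS 1 g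
    rcases Nat.lt_or_ge r ((SimpleGraph.mulCayley S).dist 1 g) with h | h
    · right
      have e : (SimpleGraph.mulCayley S).dist 1 g = r + 1 := le_antisymm hg h
      rw [e] at hp
      have hd := hp.dist_eq hS (Nat.zero_le r) (Nat.le_succ r)
      rw [hp.start] at hd
      refine ⟨p r, by simp [hd], (p r)⁻¹ * g, ?_, by simp⟩
      have ha := hp.adj r (Nat.lt_succ_self r)
      rw [hp.finish, SimpleGraph.mulCayley_adj'] at ha
      obtain ⟨-, s, hs, k | k⟩ := ha
      · left; rw [← k]; simpa using hs
      · right; rw [k]; simpa using hs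
    · exact Or.inl h

/-! ### Growth of commuting elements in a hyperbolic group. -/

/-- Translation by `h` moves a vertex far from the ends of a geodesic from `1` to an element that
commutes with `h` close to a vertex of the same geodesic. -/
theorem exists_dist_mul_le (hS : Subgroup.closure S = ⊤) {D : ℕ}
    (hD : ∀ (x y z : Γ) (p q r : ℕ → Γ) (l m n : ℕ), IsVertexGeodesic S p l x y →
      IsVertexGeodesic S q m y z → IsVertexGeodesic S r n z x → ∀ i ≤ l,
        (∃ j ≤ m, (SimpleGraph.mulCayley S).dist (p i) (q j) ≤ D) ∨
        (∃ j ≤ n, (SimpleGraph.mulCayley S).dist (p i) (r j) ≤ D))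
    {g h : Γ} (hgh : Commute g h) {R : ℕ} (hR : (SimpleGraph.mulCayley S).dist 1 h ≤ R)
    {c : ℕ → Γ} {n : ℕ} (hc : IsVertexGeodesic S c n 1 g) {t : ℕ} (ht : R + 2 * D < t)
    (htn : t + R + 2 * D < n) :
    ∃ k ∈ Finset.Icc (t - (R + 2 * D)) (t + (R + 2 * D)),
      (SimpleGraph.mulCayley S).dist (c k) (h * c t) ≤ 2 * D := by
  obtain ⟨q, hq⟩ := exists_isVertexGeodesic hS (h * g) 1
  obtain ⟨r, hr⟩ := exists_isVertexGeodesic hS 1 (h * 1)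
  obtain ⟨r', hr'⟩ := exists_isVertexGeodesic hS g (h * g)
  have tri := fun u v w => (connected hS).dist_triangle (u := u) (v := v) (w := w)
  have comm := fun u v => (SimpleGraph.mulCayley S).dist_comm (u := u) (v := v)
  have lr : (SimpleGraph.mulCayley S).dist 1 (h * 1) ≤ R := by simpa using hR
  have lr' : (SimpleGraph.mulCayley S).dist g (h * g) ≤ R := by
    rw [← hgh.eq]
    simpa using (dist_mul_left (S := S) g 1 h).trans_le hR
  have t0 := hc.dist_eq hS (Nat.zero_le t) (by omega)
  have tn := hc.dist_eq hS (show t ≤ n by omega) le_rfl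
  rw [hc.start] at t0
  rw [hc.finish] at tn
  have s0 := dist_mul_left (S := S) h 1 (c t)
  have sn := dist_mul_left (S := S) h (c t) g
  -- The quadrilateral 1, g, hg = gh, h has two long sides `c` and h·`c` and two short sides of
  -- length at most R. The diagonal `q` cuts it into two triangles, each thin.
  rcases hD _ _ _ _ _ _ _ _ _ (hc.mul_left h) hq hr t (by omega) with ⟨j, hj, d⟩ | ⟨j, hj, d⟩
  · rcases hD _ _ _ _ _ _ _ _ _ hq hc hr' j hj with ⟨k, hk, d'⟩ | ⟨k, hk, d'⟩
    · have dk : (SimpleGraph.mulCayley S).dist (c k) (h * c t) ≤ 2 * D := by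
        have := tri (c k) (q j) (h * c t)
        rw [comm (c k) (q j), comm (q j) (h * c t)] at this
        omega
      refine ⟨k, ?_, dk⟩
      -- The distances of `c k` and h·`c t` from 1 differ by at most 2D, and the latter differs from
      -- t by at most R, hence |k - t| ≤ R + 2D.
      have k0 := hc.dist_eq hS (Nat.zero_le k) hk
      rw [hc.start] at k0
      have a1 := tri 1 (c k) (h * c t)
      have a2 := tri (h * 1) 1 (h * c t)
      have a3 := tri 1 (h * c t) (c k)
      have a4 := tri 1 (h * 1) (h * c t)
      rw [comm (h * c t) (c k)] at a3
      rw [comm (h * 1) 1] at a2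
      rw [Finset.mem_Icc]
      omega
    -- Otherwise h·`c t` would be within R + 2D of hg, although its distance from hg is n - t.
    · exfalso
      have e := hr'.dist_eq hS hk le_rfl
      rw [hr'.finish] at e
      have a1 := tri (h * c t) (q j) (h * g)
      have a2 := tri (q j) (r' k) (h * g)
      omega
  -- Otherwise h·`c t` would be within R + D of h, although its distance from h is t.
  · exfalso
    have e := hr.dist_eq hS hj le_rfl
    rw [hr.finish] at e
    have a1 := tri (h * c t) (r j) (h * 1)
    rw [comm (h * c t) (h * 1)] at a1
    omega

/-- In a hyperbolic group, the sets of elements that commute with arbitrarily long elements have at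
most linear growth. -/
theorem exists_card_le (hfin : S.Finite) (hX : HasThinTriangles (CayleyGraph S hS)) :
    ∃ D N : ℕ, ∀ (R : ℕ) (F : Finset Γ), (∀ h ∈ F, (SimpleGraph.mulCayley S).dist 1 h ≤ R) →
      (∃ g, (∀ h ∈ F, Commute g h) ∧
        2 * (R + 2 * D + 1) ≤ (SimpleGraph.mulCayley S).dist 1 g) →
      F.card ≤ (2 * (R + 2 * D) + 1) * N := by
  obtain ⟨D, hD⟩ := exists_thin_vertex hX
  let B := (finite_ball hS hfin (2 * D)).toFinset
  refine ⟨D, B.card, ?_⟩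
  rintro R F hF ⟨g, hg, hlen⟩
  obtain ⟨c, hc⟩ := exists_isVertexGeodesic hS 1 g
  set n := (SimpleGraph.mulCayley S).dist 1 g
  set t := R + 2 * D + 1 with ht
  have key : ∀ h ∈ F, ∃ k ∈ Finset.Icc (t - (R + 2 * D)) (t + (R + 2 * D)),
      (SimpleGraph.mulCayley S).dist (c k) (h * c t) ≤ 2 * D := fun h hh =>
    exists_dist_mul_le hS hD (hg h hh) (hF h hh) hc (by omega) (by omega)
  choose! k hk hk' using key
  -- Both `c` and t are independent of h, so h is recovered from the index k h and the displacement
  -- from `c (k h)` to h·`c t`, which lies in a fixed finite ball.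
  have := Finset.card_le_card_of_injOn
    (t := Finset.Icc (t - (R + 2 * D)) (t + (R + 2 * D)) ×ˢ B)
    (fun h => (k h, (c (k h))⁻¹ * (h * c t))) (fun h hh => ?_) (fun h hh h' hh' e => ?_)
    (s := F)
  · rw [Finset.card_product, Nat.card_Icc] at this
    refine this.trans (Nat.mul_le_mul_right _ (by omega))
  · simp only [Finset.coe_product, Set.mem_prod, Finset.mem_coe]
    refine ⟨hk h hh, ?_⟩
    simp only [B, Set.Finite.mem_toFinset, Set.mem_ofPred_eq]
    have := dist_mul_left (S := S) (c (k h)) 1 ((c (k h))⁻¹ * (h * c t))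
    rw [mul_one, mul_inv_cancel_left] at this
    rw [← this]
    exact hk' h hh
  · obtain ⟨e1, e2⟩ := Prod.mk.inj e
    rw [e1] at e2
    exact mul_right_cancel (mul_left_cancel e2)

theorem dist_one_mul_le (hS : Subgroup.closure S = ⊤) (x y : Γ) :
    (SimpleGraph.mulCayley S).dist 1 (x * y) ≤
      (SimpleGraph.mulCayley S).dist 1 x + (SimpleGraph.mulCayley S).dist 1 y := by
  have := (connected hS).dist_triangle (u := 1) (v := x) (w := x * y)
  have e := dist_mul_left (S := S) x 1 y
  rw [mul_one] at e
  omega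

theorem dist_one_pow_le (hS : Subgroup.closure S = ⊤) (x : Γ) (i : ℕ) :
    (SimpleGraph.mulCayley S).dist 1 (x ^ i) ≤ i * (SimpleGraph.mulCayley S).dist 1 x := by
  induction i with
  | zero => simp
  | succ i ih =>
    rw [pow_succ, add_mul, one_mul]
    exact (dist_one_mul_le hS _ _).trans (Nat.add_le_add_right ih _)

end CayleyPoint

/-- A hyperbolic group contains no two commuting elements whose powers are independent. -/
theorem not_isHyperbolicGroup_of_commute {Γ : Type*} [Group Γ] {a b : Γ} (hab : Commute a b)
    (hinj : Function.Injective fun x : ℕ × ℕ => a ^ x.1 * b ^ x.2) : ¬ IsHyperbolicGroup Γ := by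
  rintro ⟨S, hS, hfin, hX⟩
  obtain ⟨D, N, h⟩ := CayleyPoint.exists_card_le hfin hX
  set L := (SimpleGraph.mulCayley S).dist 1 a + (SimpleGraph.mulCayley S).dist 1 b with hL
  -- The m² products with exponents below m lie in the ball of radius mL, where the linear bound
  -- allows at most m(m - 1) of them.
  set m := (2 * L + 4 * D + 1) * N + 1 with hm
  have hcomm (x y : ℕ × ℕ) : Commute (a ^ x.1 * b ^ x.2) (a ^ y.1 * b ^ y.2) :=
    (((Commute.refl a).pow_pow _ _).mul_right (hab.pow_pow _ _)).mul_left
      ((hab.symm.pow_pow _ _).mul_right ((Commute.refl b).pow_pow _ _))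
  have hc := h (m * L)
    ((Finset.range m ×ˢ Finset.range m).map ⟨fun x : ℕ × ℕ => a ^ x.1 * b ^ x.2, hinj⟩) ?_ ?_
  · rw [Finset.card_map, Finset.card_product, Finset.card_range] at hc
    have : (2 * (m * L + 2 * D) + 1) * N ≤ m * ((2 * L + 4 * D + 1) * N) := by
      have h1 : 1 ≤ m := by omega
      calc (2 * (m * L + 2 * D) + 1) * N ≤ (m * (2 * L + 4 * D + 1)) * N := by
            refine Nat.mul_le_mul_right _ ?_
            nlinarith
        _ = _ := by ring
    have h3 : m * m = m * ((2 * L + 4 * D + 1) * N) + m := by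
      conv_lhs => rw [hm]
      rw [← hm]; nlinarith
    omega
  · intro x hx
    obtain ⟨⟨i, j⟩, hij, rfl⟩ := Finset.mem_map.1 hx
    rw [Finset.mem_product, Finset.mem_range, Finset.mem_range] at hij
    refine (CayleyPoint.dist_one_mul_le hS _ _).trans ?_
    rw [hL, mul_add]
    exact add_le_add
      ((CayleyPoint.dist_one_pow_le hS a i).trans (Nat.mul_le_mul_right _ hij.1.le))
      ((CayleyPoint.dist_one_pow_le hS b j).trans (Nat.mul_le_mul_right _ hij.2.le))
  -- The long element commuting with all the others is itself some a^i b^j: there are infinitely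
  -- many, and balls are finite.
  · obtain ⟨_, ⟨x, rfl⟩, hx⟩ := (Set.infinite_range_of_injective hinj).exists_notMem_finite
      (CayleyPoint.finite_ball hS hfin (2 * (m * L + 2 * D + 1)))
    refine ⟨_, fun y hy => ?_, (not_le.1 hx).le⟩
    obtain ⟨y, -, rfl⟩ := Finset.mem_map.1 hy
    exact hcomm x y

/-! ### Normal forms, centralizers and retractions in free products. -/

namespace Monoid.CoprodI

variable {ι : Type*} {A : ι → Type*} [∀ i, Group (A i)]

theorem Word.prod_injective : Function.Injective (Word.prod : Word A → CoprodI A) := by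
  classical exact Word.equiv.symm.injective

theorem NeWord.prod_ne_one {i j : ι} (w : NeWord A i j) : w.prod ≠ 1 := by
  intro h
  have := Word.prod_injective (h.trans Word.prod_empty.symm)
  exact w.toList_ne_nil (congrArg Word.toList this)

/-- An element that commutes with a nontrivial element of a factor belongs to this factor. -/
theorem exists_eq_of_of_commute {i : ι} {a : A i} (ha : a ≠ 1) {x : CoprodI A}
    (h : Commute (of a) x) : ∃ b : A i, x = of b := by
  classical
  obtain ⟨w, rfl⟩ : ∃ w : Word A, w.prod = x := Word.equiv.symm.surjective x
  obtain ⟨⟨b, t, ht⟩, rfl⟩ : ∃ p : Word.Pair A i, Word.rcons p = w :=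
    (Word.equivPair i).symm.surjective w
  rw [Word.prod_rcons] at h ⊢
  dsimp only at h ⊢
  by_cases e : t = Word.empty
  · exact ⟨b, by rw [e, Word.prod_empty, mul_one]⟩
  obtain ⟨k, l, t', rfl⟩ := NeWord.of_word t e
  have hk : k ≠ i := by
    rintro rfl
    apply ht
    rw [Word.fstIdx]
    change Option.map Sigma.fst t'.toList.head? = _
    rw [NeWord.toList_head?]
    rfl
  have hb : b⁻¹ * a * b ≠ 1 := by
    intro h1
    apply ha
    have h2 := congrArg (fun z => b * z * b⁻¹) h1
    simpa [mul_assoc] using h2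
  -- Writing x = b t with t not starting in A i, the identity a = x⁻¹ a x = t⁻¹ (b⁻¹ a b) t equates
  -- a reduced word of length 1 with one of length at least 3 unless t is empty.
  let u := (t'.inv.append hk (NeWord.singleton (b⁻¹ * a * b) hb)).append hk.symm t'
  have hu : u.prod = (NeWord.singleton a ha).prod := by
    change of a * (of b * t'.prod) = (of b * t'.prod) * of a at h
    have h1 : of a = (of b * t'.prod)⁻¹ * (of a * (of b * t'.prod)) := by rw [h]; group
    simp only [u, NeWord.append_prod, NeWord.inv_prod, NeWord.prod_singleton, map_mul, map_inv]
    conv_rhs => rw [h1]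
    group
  have hl := congrArg (fun w => w.toList.length) (Word.prod_injective hu)
  have hpos := List.length_pos_of_ne_nil t'.toList_ne_nil
  change u.toList.length = 1 at hl
  simp only [u, NeWord.toList, List.length_append, List.length_singleton] at hl
  omega

/-- The alternating word abab…ab is already reduced, and a nonempty reduced word is nontrivial. -/
theorem pow_of_mul_of_ne_one {i j : ι} (hij : i ≠ j) {a : A i} {b : A j} (ha : a ≠ 1)
    (hb : b ≠ 1) {n : ℕ} (hn : n ≠ 0) : (of a * of b : CoprodI A) ^ n ≠ 1 := by
  have key (n : ℕ) : ∃ w : NeWord A i j, w.prod = (of a * of b : CoprodI A) ^ (n + 1) := by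
    induction n with
    | zero => exact ⟨(NeWord.singleton a ha).append hij (NeWord.singleton b hb), by simp⟩
    | succ n ih =>
      obtain ⟨w, hw⟩ := ih
      exact ⟨w.append hij.symm ((NeWord.singleton a ha).append hij (NeWord.singleton b hb)),
        by simp [hw, pow_succ]⟩
  obtain ⟨m, rfl⟩ := Nat.exists_eq_succ_of_ne_zero hn
  obtain ⟨w, hw⟩ := key m
  exact hw ▸ w.prod_ne_one

section TwoFactors

variable (A) (j₁ j₂ : ι)

/-- The inclusion of the free product of two of the factors. -/
def ofCoprod : Coprod (A j₁) (A j₂) →* CoprodI A := Coprod.lift of of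

@[simp]
theorem ofCoprod_inl (a : A j₁) : ofCoprod A j₁ j₂ (.inl a) = of a := rfl

@[simp]
theorem ofCoprod_inr (a : A j₂) : ofCoprod A j₁ j₂ (.inr a) = of a := rfl

/-- The retraction onto the free product of two of the factors. -/
def toCoprod [DecidableEq ι] : CoprodI A →* Coprod (A j₁) (A j₂) :=
  lift fun k => if h : k = j₁ then h ▸ Coprod.inl else if h : k = j₂ then h ▸ Coprod.inr else 1

variable {A j₁ j₂}

theorem toCoprod_ofCoprod [DecidableEq ι] (hj : j₁ ≠ j₂) (x : Coprod (A j₁) (A j₂)) :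
    toCoprod A j₁ j₂ (ofCoprod A j₁ j₂ x) = x := by
  have : (toCoprod A j₁ j₂).comp (ofCoprod A j₁ j₂) = MonoidHom.id _ := by
    apply Coprod.hom_ext
    · ext a
      simp [toCoprod]
    · ext a
      simp [toCoprod, hj.symm]
  exact DFunLike.congr_fun this x

theorem toCoprod_of [DecidableEq ι] {i : ι} (h₁ : i ≠ j₁) (h₂ : i ≠ j₂) (a : A i) :
    toCoprod A j₁ j₂ (of a) = 1 := by
  simp [toCoprod, h₁, h₂]

theorem ofCoprod_injective (hj : j₁ ≠ j₂) : Function.Injective (ofCoprod A j₁ j₂) := by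
  classical exact Function.LeftInverse.injective (toCoprod_ofCoprod hj)

/-- Elements of two different factors generate an element of infinite order. -/
theorem pow_inl_mul_inr_injective (hj : j₁ ≠ j₂) {a : A j₁} {b : A j₂} (ha : a ≠ 1) (hb : b ≠ 1) :
    Function.Injective fun n : ℕ => (Coprod.inl a * Coprod.inr b : Coprod (A j₁) (A j₂)) ^ n := by
  rw [injective_pow_iff_not_isOfFinOrder, isOfFinOrder_iff_pow_eq_one]
  rintro ⟨n, hn, h⟩
  apply pow_of_mul_of_ne_one hj ha hb hn.ne'
  simpa using congrArg (ofCoprod A j₁ j₂) h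

end TwoFactors

end Monoid.CoprodI

/-! ### Simultaneous conjugation of factors by elements of A j₁ * A j₂. -/

section MultiConj

open Monoid Monoid.CoprodI

variable {ι : Type*} [DecidableEq ι] (A : ι → Type*) [∀ i, Group (A i)] (j₁ j₂ : ι)

/-- The endomorphism that fixes the factors `A j₁` and `A j₂` and conjugates each other factor
`A i` by the inverse of `p i`. -/
def multiConjHom (p : {i : ι // i ≠ j₁ ∧ i ≠ j₂} → Coprod (A j₁) (A j₂)) :
    CoprodI A →* CoprodI A :=
  CoprodI.lift fun k =>
    if h : k ≠ j₁ ∧ k ≠ j₂ then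
      (MulAut.conj (ofCoprod A j₁ j₂ (p ⟨k, h⟩))⁻¹).toMonoidHom.comp CoprodI.of
    else CoprodI.of

variable {A j₁ j₂}

theorem multiConjHom_of (p : {i : ι // i ≠ j₁ ∧ i ≠ j₂} → Coprod (A j₁) (A j₂))
    (i : {i : ι // i ≠ j₁ ∧ i ≠ j₂}) (a : A i) :
    multiConjHom A j₁ j₂ p (of a) =
      (ofCoprod A j₁ j₂ (p i))⁻¹ * of a * ofCoprod A j₁ j₂ (p i) := by
  simp [multiConjHom, i.2.1, i.2.2]

theorem multiConjHom_of_eq (p : {i : ι // i ≠ j₁ ∧ i ≠ j₂} → Coprod (A j₁) (A j₂))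
    {k : ι} (hk : ¬ (k ≠ j₁ ∧ k ≠ j₂)) (a : A k) : multiConjHom A j₁ j₂ p (of a) = of a := by
  simp only [multiConjHom, CoprodI.lift_of, dif_neg hk]

theorem multiConjHom_ofCoprod (p : {i : ι // i ≠ j₁ ∧ i ≠ j₂} → Coprod (A j₁) (A j₂))
    (x : Coprod (A j₁) (A j₂)) :
    multiConjHom A j₁ j₂ p (ofCoprod A j₁ j₂ x) = ofCoprod A j₁ j₂ x := by
  have : (multiConjHom A j₁ j₂ p).comp (ofCoprod A j₁ j₂) = ofCoprod A j₁ j₂ := by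
    apply Coprod.hom_ext
    · ext a
      exact multiConjHom_of_eq p (by simp) a
    · ext a
      exact multiConjHom_of_eq p (by simp) a
  exact DFunLike.congr_fun this x

/-- Since the map for p fixes q k, applying it to (q k)⁻¹ a (q k) puts (p k)⁻¹ and p k inside. The
inverse in the definition thus makes this a homomorphism rather than an antihomomorphism. -/
theorem multiConjHom_mul (p q : {i : ι // i ≠ j₁ ∧ i ≠ j₂} → Coprod (A j₁) (A j₂)) :
    multiConjHom A j₁ j₂ (p * q) = (multiConjHom A j₁ j₂ p).comp (multiConjHom A j₁ j₂ q) := by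
  ext k a
  simp only [MonoidHom.comp_apply]
  by_cases hk : k ≠ j₁ ∧ k ≠ j₂
  · rw [multiConjHom_of _ ⟨k, hk⟩, multiConjHom_of _ ⟨k, hk⟩]
    simp only [map_mul, map_inv, multiConjHom_ofCoprod, multiConjHom_of _ ⟨k, hk⟩, Pi.mul_apply]
    group
  · rw [multiConjHom_of_eq _ hk, multiConjHom_of_eq _ hk, multiConjHom_of_eq _ hk]

theorem multiConjHom_one : multiConjHom A j₁ j₂ 1 = MonoidHom.id _ := by
  ext k a
  by_cases hk : k ≠ j₁ ∧ k ≠ j₂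
  · simp [multiConjHom_of _ ⟨k, hk⟩]
  · simp [multiConjHom_of_eq _ hk]

variable (A j₁ j₂) in
/-- The action of a power of `A j₁ * A j₂` on the free product by conjugation of the factors. -/
def multiConj : ({i : ι // i ≠ j₁ ∧ i ≠ j₂} → Coprod (A j₁) (A j₂)) →* MulAut (CoprodI A) where
  toFun p := MonoidHom.toMulEquiv (multiConjHom A j₁ j₂ p) (multiConjHom A j₁ j₂ p⁻¹)
    (by rw [← multiConjHom_mul, inv_mul_cancel, multiConjHom_one])
    (by rw [← multiConjHom_mul, mul_inv_cancel, multiConjHom_one])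
  map_one' := MulEquiv.toMonoidHom_injective multiConjHom_one
  map_mul' p q := MulEquiv.toMonoidHom_injective (multiConjHom_mul p q)

theorem multiConj_apply (p : {i : ι // i ≠ j₁ ∧ i ≠ j₂} → Coprod (A j₁) (A j₂)) (x : CoprodI A) :
    multiConj A j₁ j₂ p x = multiConjHom A j₁ j₂ p x := rfl

variable (A j₁ j₂) in
/-- The outer automorphisms given by `multiConj`. -/
def outerMultiConj : ({i : ι // i ≠ j₁ ∧ i ≠ j₂} → Coprod (A j₁) (A j₂)) →* Out (CoprodI A) :=
  (QuotientGroup.mk' _).comp (multiConj A j₁ j₂)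

theorem outerMultiConj_injective [∀ i, Nontrivial (A i)] (hj : j₁ ≠ j₂) :
    Function.Injective (outerMultiConj A j₁ j₂) := by
  rw [injective_iff_map_eq_one]
  intro p hp
  obtain ⟨g, hg⟩ : multiConj A j₁ j₂ p ∈ (MulAut.conj : CoprodI A →* _).range :=
    (QuotientGroup.eq_one_iff _).1 hp
  have hg (x : CoprodI A) : g * x * g⁻¹ = multiConjHom A j₁ j₂ p x := by
    rw [← multiConj_apply, ← hg, MulAut.conj_apply]
  have fixed {k : ι} (hk : ¬ (k ≠ j₁ ∧ k ≠ j₂)) (a : A k) : Commute (of a) g := by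
    have := hg (of a)
    rw [multiConjHom_of_eq _ hk, mul_inv_eq_iff_eq_mul] at this
    exact this.symm
  obtain ⟨a₁, h₁⟩ := exists_ne (1 : A j₁)
  obtain ⟨a₂, h₂⟩ := exists_ne (1 : A j₂)
  obtain ⟨b₁, rfl⟩ := exists_eq_of_of_commute h₁ (fixed (by simp) a₁)
  obtain ⟨b₂, hb⟩ := exists_eq_of_of_commute h₂ (fixed (by simp) a₂)
  -- The conjugator lies in both A j₁ and A j₂; projecting A j₁ * A j₂ to A j₁ shows that it is
  -- trivial.
  have hb₁ : b₁ = 1 := by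
    have h : (Coprod.inl b₁ : Coprod (A j₁) (A j₂)) = Coprod.inr b₂ :=
      ofCoprod_injective hj hb
    simpa using congrArg Coprod.fst h
  subst hb₁
  funext i
  obtain ⟨a, ha⟩ := exists_ne (1 : A i)
  have hc : Commute (of a) (ofCoprod A j₁ j₂ (p i)) := by
    have := hg (of a)
    rw [multiConjHom_of, map_one, one_mul, inv_one, mul_one, mul_assoc,
      eq_inv_mul_iff_mul_eq] at this
    exact this.symm
  obtain ⟨b, hb⟩ := exists_eq_of_of_commute ha hc
  -- The retraction onto A j₁ * A j₂ fixes p i but kills A i, to which p i has been shown to belong.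
  rw [← toCoprod_ofCoprod hj (p i), hb, toCoprod_of i.2.1 i.2.2, Pi.one_apply]

theorem outerMultiConj_mulSingle_inl (i : {i : ι // i ≠ j₁ ∧ i ≠ j₂}) (a : A j₁) :
    outerMultiConj A j₁ j₂ (Pi.mulSingle i (Coprod.inl a)) = outerPartialConj i.1 j₁ a⁻¹ := by
  refine congrArg QuotientGroup.mk (MulEquiv.toMonoidHom_injective ?_)
  change multiConjHom A j₁ j₂ _ = partialConjHom i.1 (of a⁻¹)
  ext k b
  by_cases hk : k ≠ j₁ ∧ k ≠ j₂
  · obtain ⟨i, hi⟩ := i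
    by_cases hki : k = i
    · subst hki
      simp [multiConjHom_of _ ⟨k, hk⟩, partialConjHom]
    · have : (⟨k, hk⟩ : {i : ι // i ≠ j₁ ∧ i ≠ j₂}) ≠ ⟨i, hi⟩ := fun e => hki (congrArg Subtype.val e)
      simp [multiConjHom_of _ ⟨k, hk⟩, partialConjHom, hki, this]
  · have : k ≠ i := by rintro rfl; exact hk i.2
    simp [multiConjHom_of_eq _ hk, partialConjHom, this]

theorem outerMultiConj_mulSingle_inr (i : {i : ι // i ≠ j₁ ∧ i ≠ j₂}) (a : A j₂) :
    outerMultiConj A j₁ j₂ (Pi.mulSingle i (Coprod.inr a)) = outerPartialConj i.1 j₂ a⁻¹ := by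
  refine congrArg QuotientGroup.mk (MulEquiv.toMonoidHom_injective ?_)
  change multiConjHom A j₁ j₂ _ = partialConjHom i.1 (of a⁻¹)
  ext k b
  by_cases hk : k ≠ j₁ ∧ k ≠ j₂
  · obtain ⟨i, hi⟩ := i
    by_cases hki : k = i
    · subst hki
      simp [multiConjHom_of _ ⟨k, hk⟩, partialConjHom]
    · have : (⟨k, hk⟩ : {i : ι // i ≠ j₁ ∧ i ≠ j₂}) ≠ ⟨i, hi⟩ := fun e => hki (congrArg Subtype.val e)
      simp [multiConjHom_of _ ⟨k, hk⟩, partialConjHom, hki, this]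
  · have : k ≠ i := by rintro rfl; exact hk i.2
    simp [multiConjHom_of_eq _ hk, partialConjHom, this]

end MultiConj

/-! ### Identification with the groups H and conclusion. -/

section Main

open Monoid Monoid.CoprodI

variable {ι : Type*} [DecidableEq ι] {A : ι → Type*} [∀ i, Group (A i)] [∀ i, Nontrivial (A i)]
  {j₁ j₂ : ι}

/-- The factor `A j₁` is isomorphic to the group of outer partial conjugations by its elements. -/
noncomputable def equivOuterPartialConjLeft (hj : j₁ ≠ j₂) (i : {i : ι // i ≠ j₁ ∧ i ≠ j₂}) :
    A j₁ ≃* outerPartialConjSubgroup A i j₁ :=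
  MulEquiv.ofBijective
    (((outerMultiConj A j₁ j₂).comp ((MonoidHom.mulSingle _ i).comp Coprod.inl)).codRestrict
      (outerPartialConjSubgroup A i j₁) fun a => ⟨a⁻¹, (outerMultiConj_mulSingle_inl i a).symm⟩)
    ⟨fun _ _ h => Coprod.inl_injective (Pi.mulSingle_injective i
      (outerMultiConj_injective hj (congrArg Subtype.val h))), by
      rintro ⟨_, a, rfl⟩
      -- Partial conjugations compose in reversed order of their conjugators, so the isomorphism
      -- sends a to the partial conjugation by a⁻¹.
      exact ⟨a⁻¹, Subtype.ext ((outerMultiConj_mulSingle_inl i a⁻¹).trans (by rw [inv_inv]))⟩⟩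

/-- The factor `A j₂` is isomorphic to the group of outer partial conjugations by its elements. -/
noncomputable def equivOuterPartialConjRight (hj : j₁ ≠ j₂) (i : {i : ι // i ≠ j₁ ∧ i ≠ j₂}) :
    A j₂ ≃* outerPartialConjSubgroup A i j₂ :=
  MulEquiv.ofBijective
    (((outerMultiConj A j₁ j₂).comp ((MonoidHom.mulSingle _ i).comp Coprod.inr)).codRestrict
      (outerPartialConjSubgroup A i j₂) fun a => ⟨a⁻¹, (outerMultiConj_mulSingle_inr i a).symm⟩)
    ⟨fun _ _ h => Coprod.inr_injective (Pi.mulSingle_injective i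
      (outerMultiConj_injective hj (congrArg Subtype.val h))), by
      rintro ⟨_, a, rfl⟩
      exact ⟨a⁻¹, Subtype.ext ((outerMultiConj_mulSingle_inr i a⁻¹).trans (by rw [inv_inv]))⟩⟩

/-- The free product of two groups of outer partial conjugations of `A i`. -/
noncomputable def coprodEquivOuterPartialConj (hj : j₁ ≠ j₂) (i : {i : ι // i ≠ j₁ ∧ i ≠ j₂}) :
    Coprod (A j₁) (A j₂) ≃*
      Coprod (outerPartialConjSubgroup A i j₁) (outerPartialConjSubgroup A i j₂) :=
  (equivOuterPartialConjLeft hj i).coprodCongr (equivOuterPartialConjRight hj i)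

theorem lift_subtype_coprodEquivOuterPartialConj (hj : j₁ ≠ j₂) (i : {i : ι // i ≠ j₁ ∧ i ≠ j₂})
    (x : Coprod (A j₁) (A j₂)) :
    Coprod.lift (outerPartialConjSubgroup A i j₁).subtype
      (outerPartialConjSubgroup A i j₂).subtype (coprodEquivOuterPartialConj hj i x) =
      outerMultiConj A j₁ j₂ (Pi.mulSingle i x) := by
  have : (Coprod.lift (outerPartialConjSubgroup A i j₁).subtype
      (outerPartialConjSubgroup A i j₂).subtype).comp (coprodEquivOuterPartialConj hj i).toMonoidHom =
      (outerMultiConj A j₁ j₂).comp (MonoidHom.mulSingle _ i) :=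
    Coprod.hom_ext (MonoidHom.ext fun _ => rfl) (MonoidHom.ext fun _ => rfl)
  exact DFunLike.congr_fun this x

/-- The map is `outerMultiConj`, transported coordinatewise along the identifications of A j₁ and A
j₂ with the subgroups of outer partial conjugations. -/
theorem exists_injective_outer (hj : j₁ ≠ j₂) :
    ∃ Θ : ((i : {i : ι // i ≠ j₁ ∧ i ≠ j₂}) →
        Coprod (outerPartialConjSubgroup A i j₁) (outerPartialConjSubgroup A i j₂)) →*
          Out (CoprodI A),
      Function.Injective Θ ∧
      ∀ (i : {i : ι // i ≠ j₁ ∧ i ≠ j₂})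
        (x : Coprod (outerPartialConjSubgroup A i j₁) (outerPartialConjSubgroup A i j₂)),
        Θ (Pi.mulSingle i x) =
          Coprod.lift (outerPartialConjSubgroup A i j₁).subtype
            (outerPartialConjSubgroup A i j₂).subtype x := by
  let e := MulEquiv.piCongrRight fun i => (coprodEquivOuterPartialConj (A := A) hj i).symm
  refine ⟨(outerMultiConj A j₁ j₂).comp e.toMonoidHom,
    (outerMultiConj_injective hj).comp e.injective, fun i x => ?_⟩
  obtain ⟨y, rfl⟩ := (coprodEquivOuterPartialConj hj i).surjective x
  rw [lift_subtype_coprodEquivOuterPartialConj]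
  refine congrArg (outerMultiConj A j₁ j₂) ?_
  funext k
  by_cases h : k = i
  · subst h
    simp [e]
  · simp [e, h]

theorem infinite_coprod_outerPartialConj (hj : j₁ ≠ j₂) (i : {i : ι // i ≠ j₁ ∧ i ≠ j₂}) :
    Infinite (Coprod (outerPartialConjSubgroup A i j₁) (outerPartialConjSubgroup A i j₂)) := by
  obtain ⟨a, ha⟩ := exists_ne (1 : A j₁)
  obtain ⟨b, hb⟩ := exists_ne (1 : A j₂)
  have : Infinite (Coprod (A j₁) (A j₂)) :=
    Infinite.of_injective _ (pow_inl_mul_inr_injective hj ha hb)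
  exact (coprodEquivOuterPartialConj hj i).toEquiv.infinite_iff.1 this

/-- An element ab of infinite order, placed in two different coordinates, gives two commuting
elements whose exponents can be read off separately. -/
theorem not_isHyperbolicGroup_out (hj : j₁ ≠ j₂) {i₁ i₂ : {i : ι // i ≠ j₁ ∧ i ≠ j₂}}
    (hi : i₁ ≠ i₂) : ¬ IsHyperbolicGroup (Out (CoprodI A)) := by
  obtain ⟨a, ha⟩ := exists_ne (1 : A j₁)
  obtain ⟨b, hb⟩ := exists_ne (1 : A j₂)
  set c : Coprod (A j₁) (A j₂) := Coprod.inl a * Coprod.inr b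
  have hpow := pow_inl_mul_inr_injective hj ha hb
  refine not_isHyperbolicGroup_of_commute (a := outerMultiConj A j₁ j₂ (Pi.mulSingle i₁ c))
    (b := outerMultiConj A j₁ j₂ (Pi.mulSingle i₂ c))
    ((Pi.mulSingle_commute (f := fun _ => Coprod (A j₁) (A j₂)) hi c c).map
      (outerMultiConj A j₁ j₂)) ?_
  rintro ⟨m, n⟩ ⟨m', n'⟩ h
  simp only [← map_pow, ← map_mul] at h
  have h := outerMultiConj_injective hj h
  have h₁ := congrFun h i₁
  have h₂ := congrFun h i₂
  simp only [Pi.mul_apply, Pi.pow_apply, Pi.mulSingle_eq_same, Pi.mulSingle_eq_of_ne hi,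
    Pi.mulSingle_eq_of_ne hi.symm, one_pow, one_mul, mul_one] at h₁ h₂
  exact Prod.ext (hpow h₁) (hpow h₂)

end Main

theorem mainTheorem8 {n : ℕ} (hn : 4 ≤ n) (A : Fin n → Type*) [∀ i, Group (A i)]
    [∀ i, Finite (A i)] [∀ i, Nontrivial (A i)] :
    ¬ IsHyperbolicGroup (Out (Monoid.CoprodI A)) ∧
    ∀ j₁ j₂ : Fin n, j₁ ≠ j₂ →
      2 ≤ Nat.card {i : Fin n // i ≠ j₁ ∧ i ≠ j₂} ∧
      (∀ i : {i : Fin n // i ≠ j₁ ∧ i ≠ j₂},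
        Infinite (Monoid.Coprod (outerPartialConjSubgroup A i j₁)
          (outerPartialConjSubgroup A i j₂))) ∧
      ∃ Θ : ((i : {i : Fin n // i ≠ j₁ ∧ i ≠ j₂}) →
          Monoid.Coprod (outerPartialConjSubgroup A i j₁) (outerPartialConjSubgroup A i j₂)) →*
            Out (Monoid.CoprodI A),
        Function.Injective Θ ∧
        ∀ (i : {i : Fin n // i ≠ j₁ ∧ i ≠ j₂})
          (x : Monoid.Coprod (outerPartialConjSubgroup A i j₁) (outerPartialConjSubgroup A i j₂)),
          Θ (Pi.mulSingle i x) =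
            Monoid.Coprod.lift (outerPartialConjSubgroup A i j₁).subtype
              (outerPartialConjSubgroup A i j₂).subtype x := by
  have hcard (j₁ j₂ : Fin n) (hj : j₁ ≠ j₂) :
      2 ≤ Nat.card {i : Fin n // i ≠ j₁ ∧ i ≠ j₂} := by
    have h : (Finset.univ.filter fun i : Fin n => i ≠ j₁ ∧ i ≠ j₂) = {j₁, j₂}ᶜ := by
      ext i; simp
    rw [Nat.card_eq_fintype_card, Fintype.card_subtype, h, Finset.card_compl,
      Finset.card_pair hj, Fintype.card_fin]
    omega
  refine ⟨?_, fun j₁ j₂ hj => ⟨hcard j₁ j₂ hj, infinite_coprod_outerPartialConj hj,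
    exists_injective_outer hj⟩⟩
  have h01 : (⟨0, by omega⟩ : Fin n) ≠ ⟨1, by omega⟩ := by simp
  have := Finite.one_lt_card_iff_nontrivial.1 (hcard _ _ h01)
  obtain ⟨i₁, i₂, hi⟩ := this
  exact not_isHyperbolicGroup_out h01 hi
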